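/- Let $\omega^{\uparrow\omega}$ be the set of strictly increasing functions $x:\omega\to\omega$ (identified with the infinite subsets $\operatorname{rng}(x)$ of $\omega$) and $\omega^{\uparrow<\omega}$ the set of strictly increasing finite sequences of natural numbers. A *tree* is a nonempty set $T\subseteq\omega^{\uparrow<\omega}$ closed under initial segments, and $[T]=\{x\in\omega^{\uparrow\omega} : x{\restriction}n\in T \text{ for all } n\}$ is its set of branches. * A *Sacks tree* is a tree $T$ in which every node has an extension $\tau\in T$ with at least two immediate successors in $T$. * A *willow condition* is a pair $(f,A)$ where $A$ is an infinite set of pairwise disjoint nonempty finite subsets of $\omega$ and $f:\omega\setminus\bigcup A\to\{0,1\}$. The corresponding *willow tree* consists of all finite initial segments of those $x\in\omega^{\uparrow\omega}$ for which the characteristic function of $\operatorname{rng}(x)$ extends $f$ and is constant on each $a\in A$. For a family $\mathbb{I}$ of trees, let $i^0$ be the collection of all $X\subseteq\omega^{\uparrow\omega}$ such that for every $T\in\mathbb{I}$ there is $S\in\mathbb{I}$ with $S\subseteq T$ and $X\cap[S]=\emptyset$. Let $s^0$ and $w^0$ be the collections obtained in this way from the Sacks trees (the Sacks-null, or Marczewski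 null, sets) and from the willow trees (the willow-null sets), respectively. **Theorem 2.8.** $s^0\setminus w^0\neq\emptyset$: there is a set $X\subseteq\omega^{\uparrow\omega}$ that is Sacks-null but not willow-null. -/

import Mathlib

namespace Paradise

/-- The reals `ω^{↑ω}`: the space of strictly increasing functions from `ω` to `ω`.
Such a function is identified with its range, an infinite subset of `ω`. -/
abbrev IncReal : Type := {x : ℕ → ℕ // StrictMono x}

/-- The initial segment of length `n` of the real `x`, as a finite sequence. -/
def IncReal.init (x : IncReal) (n : ℕ) : List ℕ :=
  (List.range n).map x.1

/-- The infinite subset of `ω` enumerated by `x`. -/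
def IncReal.toSet (x : IncReal) : Set ℕ :=
  Set.range x.1

/-- The set `[T]` of branches through `T`. -/
def body (T : Set (List ℕ)) : Set IncReal :=
  {x | ∀ n, x.init n ∈ T}

/-- `σ` is a splitting node of `T`: it belongs to `T` and has at least two immediate
successors in `T`. -/
def IsSplit (T : Set (List ℕ)) (σ : List ℕ) : Prop :=
  σ ∈ T ∧ ∃ m n : ℕ, m < n ∧ σ ++ [m] ∈ T ∧ σ ++ [n] ∈ T

/-- The Sacks (perfect) trees: nonempty trees of strictly increasing finite sequences of natural
numbers in which every node has an extension that is a splitting node. -/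
def sacksTrees : Set (Set (List ℕ)) :=
  {T | T ∈ Descriptive.tree ℕ ∧ T.Nonempty ∧ (∀ σ ∈ T, σ.Pairwise (· < ·)) ∧
    ∀ σ ∈ T, ∃ τ, σ <+: τ ∧ IsSplit T τ}

/-- A willow condition `(f, A)`: an infinite set `A` of pairwise disjoint nonempty finite subsets of
`ω`, and a function `f : ω \ ⋃ A → 2`. -/
structure WillowCondition where
  /-- the set `A` of blocks -/
  blocks : Set (Finset ℕ)
  infinite_blocks : blocks.Infinite
  nonempty_of_mem : ∀ a ∈ blocks, a.Nonempty
  pairwiseDisjoint : ∀ a ∈ blocks, ∀ b ∈ blocks, a ≠ b → Disjoint a b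
  /-- the function `f`, defined exactly off the union of the blocks -/
  f : {k : ℕ // ∀ a ∈ blocks, k ∉ a} → Bool

/-- The reals `x` whose characteristic function extends `f` and is constant on every block. -/
def WillowCondition.reals (c : WillowCondition) : Set IncReal :=
  {x | (∀ k, k.1 ∈ x.toSet ↔ c.f k = true) ∧
    ∀ a ∈ c.blocks, (∀ k ∈ a, k ∈ x.toSet) ∨ (∀ k ∈ a, k ∉ x.toSet)}

/-- The willow tree of a willow condition: all finite initial segments of its reals. -/
def WillowCondition.tree (c : WillowCondition) : Set (List ℕ) :=
  {σ | ∃ x ∈ c.reals, ∃ n, σ = x.init n}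

/-- The willow trees. -/
def willowTrees : Set (Set (List ℕ)) :=
  Set.range WillowCondition.tree

/-- The ideal associated with a family `𝕀` of trees, ordered by inclusion: the sets `X` of reals such
that every `T ∈ 𝕀` has a subtree `S ∈ 𝕀` with `X ∩ [S] = ∅`. -/
def treeIdeal (𝕀 : Set (Set (List ℕ))) : Set (Set IncReal) :=
  {X | ∀ T ∈ 𝕀, ∃ S ∈ 𝕀, S ⊆ T ∧ X ∩ body S = ∅}

/-- The ideal `s⁰` of Sacks-null (Marczewski null) sets. -/
def sacksIdeal : Set (Set IncReal) :=
  treeIdeal sacksTrees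

/-- The ideal `w⁰` of willow-null sets. -/
def willowIdeal : Set (Set IncReal) :=
  treeIdeal willowTrees

end Paradise

namespace Paradise

open Cardinal

/-! ### Initial segments and trees -/

/-! The separating notion is inclusion between ranges. Every Sacks tree has a Sacks subtree whose
body is a chain or an antichain for inclusion (`exists_homogeneous_subtree`). A willow tree is too
rich for this: its body contains a copy of `ℝ × 2^ω` in which each fibre over `2^ω` is a chain and
points of different fibres are incomparable. A chain meets at most one fibre and an antichain meets
each fibre at most once, so fewer than continuum many homogeneous sets cannot cover it
(`WillowCondition.exists_mem_reals_not_mem`).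

Well-order all sets of finite sequences with initial segments smaller than the continuum, and for
each willow tree `W` pick `x W` in its body outside every homogeneous body of an earlier `S`. The
set of these points meets every willow body, so it is not willow-null. It is Sacks-null: a
homogeneous Sacks tree `S` contains `x W` only for `W` equal to or before `S`, and one of its
continuum many Sacks subtrees with disjoint bodies misses those points. -/

@[simp]
theorem IncReal.length_init (x : IncReal) (n : ℕ) : (x.init n).length = n := by
  simp [IncReal.init]

theorem IncReal.init_prefix (x : IncReal) {m n : ℕ} (h : m ≤ n) : x.init m <+: x.init n := by
  obtain ⟨k, rfl⟩ := Nat.exists_eq_add_of_le h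
  simp [IncReal.init, List.range_add]

theorem IncReal.init_eq_of_prefix {x : IncReal} {σ : List ℕ} {n : ℕ} (h : σ <+: x.init n) :
    x.init σ.length = σ := by
  have hl : σ.length ≤ n := by simpa using h.length_le
  have h' := List.prefix_of_prefix_length_le (x.init_prefix hl) h (by simp)
  exact h'.eq_of_length (by simp)

theorem IncReal.prefix_init {x : IncReal} {σ : List ℕ} {n : ℕ} (h : x.init σ.length = σ)
    (hn : σ.length ≤ n) : σ <+: x.init n := by
  have := x.init_prefix hn
  rwa [h] at this

theorem IncReal.eq_of_init_eq {x y : IncReal} (h : ∀ n, x.init n = y.init n) : x = y := by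
  apply Subtype.ext
  funext k
  have := h (k + 1)
  simp only [IncReal.init, List.map_inj_left] at this
  exact this k (by simp)

theorem IncReal.mem_init {x : IncReal} {n k : ℕ} (hk : k ∈ x.toSet) (hn : k < n) :
    k ∈ x.init n := by
  obtain ⟨j, rfl⟩ := hk
  have := x.2.le_apply (x := j)
  simp only [IncReal.init, List.mem_map, List.mem_range]
  exact ⟨j, by omega, rfl⟩

theorem IncReal.mem_toSet_of_mem_init {x : IncReal} {n k : ℕ} (hk : k ∈ x.init n) :
    k ∈ x.toSet := by
  simp only [IncReal.init, List.mem_map] at hk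
  obtain ⟨j, -, rfl⟩ := hk
  exact ⟨j, rfl⟩

theorem mem_of_prefix {T : Set (List ℕ)} (hT : T ∈ Descriptive.tree ℕ) {σ τ : List ℕ}
    (h : σ <+: τ) (hτ : τ ∈ T) : σ ∈ T :=
  Descriptive.Tree.mem_of_prefix (T := (⟨T, hT⟩ : Descriptive.tree ℕ)) h hτ

/-- The set of prefixes of the members of a family of finite sequences is a tree. -/
theorem prefixes_mem_tree {ι : Type*} (g : ι → List ℕ) :
    {σ | ∃ s, σ <+: g s} ∈ Descriptive.tree ℕ := by
  rintro σ a ⟨s, hs⟩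
  exact ⟨s, (List.prefix_append _ _).trans hs⟩

/-- Every infinite set of natural numbers is the range of a real. -/
theorem exists_toSet_eq {A : Set ℕ} (hA : A.Infinite) : ∃ x : IncReal, x.toSet = A :=
  ⟨⟨Nat.nth (· ∈ A), Nat.nth_strictMono hA⟩, Nat.range_nth_of_infinite hA⟩

/-! ### Cantor schemes -/

/-- Two finite sequences are incompatible if neither is an initial segment of the other. -/
def Incompatible (u v : List ℕ) : Prop :=
  ¬ u <+: v ∧ ¬ v <+: u

/-- A Cantor scheme of finite sequences, indexed by binary sequences with the latest digit first. -/
structure IsScheme (g : List Bool → List ℕ) : Prop where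
  prefix_cons : ∀ b s, g s <+: g (b :: s)
  incompatible : ∀ s, Incompatible (g (false :: s)) (g (true :: s))

/-- The tree generated by a scheme. -/
def schemeTree (g : List Bool → List ℕ) : Set (List ℕ) :=
  {σ | ∃ s, σ <+: g s}

namespace IsScheme

variable {g : List Bool → List ℕ}

theorem prefix_of_suffix (hg : IsScheme g) {s t : List Bool} (h : s <:+ t) : g s <+: g t := by
  obtain ⟨r, rfl⟩ := h
  induction r with
  | nil => simp
  | cons b r ih => exact ih.trans (hg.prefix_cons _ _)

/-- Each digit lengthens the sequence strictly: were `g (b :: s)` equal to `g s`, it would be a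
prefix of its sibling. -/
theorem length_le (hg : IsScheme g) (s : List Bool) : s.length ≤ (g s).length := by
  induction s with
  | nil => simp
  | cons b s ih =>
    have h1 := (hg.prefix_cons b s).length_le
    rcases h1.eq_or_lt with h | h
    · have h2 := (hg.prefix_cons b s).eq_of_length h
      have h3 := hg.incompatible s
      have h4 := hg.prefix_cons (!b) s
      cases b
      · rw [← h2] at h3
        exact absurd h4 h3.1
      · rw [← h2] at h3
        exact absurd h4 h3.2
    · simp only [List.length_cons]
      omega

/-- Compactness: there are finitely many indices of length `n`, so an initial segment of `x` longer
than all their values lies below `g t` with `t` of length at least `n`; the oldest `n` digits of `t`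
serve. -/
theorem exists_prefix_of_mem_body (hg : IsScheme g) {x : IncReal} (hx : x ∈ body (schemeTree g))
    (n : ℕ) : ∃ s : List Bool, s.length = n ∧ x.init (g s).length = g s := by
  have hfin : {s : List Bool | s.length = n}.Finite := List.finite_length_eq Bool n
  obtain ⟨L, hL⟩ := (hfin.image (fun s => (g s).length)).bddAbove
  have hL' : ∀ s : List Bool, s.length = n → (g s).length ≤ L :=
    fun s hs => hL ⟨s, hs, rfl⟩
  obtain ⟨t, ht⟩ := hx (L + 1)
  have htl : L + 1 ≤ (g t).length := by simpa using ht.length_le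
  have hn : n ≤ t.length := by
    -- Padding a shorter `t` to length `n` would bound the length of `g t` by `L`.
    by_contra! hlt
    have h1 := hg.prefix_of_suffix (List.suffix_append (List.replicate (n - t.length) true) t)
    have h2 := hL' (List.replicate (n - t.length) true ++ t) (by simp; omega)
    have h3 := h1.length_le
    omega
  refine ⟨t.drop (t.length - n), by simp; omega, ?_⟩
  have h1 := hg.prefix_of_suffix (List.drop_suffix (t.length - n) t)
  have h2 := hL' (t.drop (t.length - n)) (by simp; omega)
  exact IncReal.init_eq_of_prefix
    (List.prefix_of_prefix_length_le h1 ht (by rw [IncReal.length_init]; omega))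

end IsScheme

/-- The latest digit comes first, so `r` is the shared history and `b` the first digit of
disagreement. -/
theorem exists_cons_suffix_of_ne {s t : List Bool} (hl : s.length = t.length) (h : s ≠ t) :
    ∃ r b, (b :: r) <:+ s ∧ ((!b) :: r) <:+ t := by
  induction s generalizing t with
  | nil => cases t <;> simp_all
  | cons a s ih =>
    cases t with
    | nil => simp at hl
    | cons c t =>
      by_cases hst : s = t
      · subst hst
        refine ⟨s, a, List.suffix_refl _, ?_⟩
        have : c = !a := by
          cases a <;> cases c <;> simp_all
        rw [this]
      · obtain ⟨r, b, h1, h2⟩ := ih (by simpa using hl) hst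
        exact ⟨r, b, h1.trans (List.suffix_cons _ _), h2.trans (List.suffix_cons _ _)⟩

namespace IsScheme

variable {g : List Bool → List ℕ}

/-- Distinct branches of a scheme pass through the two successors of some index. -/
theorem exists_separation (hg : IsScheme g) {x y : IncReal} (hx : x ∈ body (schemeTree g))
    (hy : y ∈ body (schemeTree g)) (h : x ≠ y) :
    ∃ r b, x.init (g (b :: r)).length = g (b :: r) ∧
      y.init (g ((!b) :: r)).length = g ((!b) :: r) := by
  have : ∃ n, x.init n ≠ y.init n := by
    by_contra! h'
    exact h (IncReal.eq_of_init_eq h')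
  obtain ⟨n, hn⟩ := this
  obtain ⟨s, hs, hxs⟩ := hg.exists_prefix_of_mem_body hx n
  obtain ⟨t, ht, hyt⟩ := hg.exists_prefix_of_mem_body hy n
  have hst : s ≠ t := by
    rintro rfl
    apply hn
    have hl := hg.length_le s
    rw [hs] at hl
    have h1 := x.init_prefix hl
    have h2 := y.init_prefix hl
    rw [hxs] at h1
    rw [hyt] at h2
    exact (List.prefix_of_prefix_length_le h1 h2 (by simp)).eq_of_length (by simp)
  obtain ⟨r, b, h1, h2⟩ := exists_cons_suffix_of_ne (hs.trans ht.symm) hst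
  refine ⟨r, b, ?_, ?_⟩
  · have h3 := hg.prefix_of_suffix h1
    rw [← hxs] at h3
    exact IncReal.init_eq_of_prefix h3
  · have h3 := hg.prefix_of_suffix h2
    rw [← hyt] at h3
    exact IncReal.init_eq_of_prefix h3

/-- A branch cannot pass through two distinct indices of the same length. -/
theorem eq_of_init (hg : IsScheme g) {x : IncReal} {s t : List Bool} (hl : s.length = t.length)
    (hs : x.init (g s).length = g s) (ht : x.init (g t).length = g t) : s = t := by
  by_contra hne
  obtain ⟨r, b, h1, h2⟩ := exists_cons_suffix_of_ne hl hne
  have h3 := hg.prefix_of_suffix h1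
  have h4 := hg.prefix_of_suffix h2
  rw [← hs] at h3
  rw [← ht] at h4
  have h5 := h3.trans (x.init_prefix (Nat.le_max_left _ (g t).length))
  have h6 := h4.trans (x.init_prefix (Nat.le_max_right (g s).length _))
  have h7 := hg.incompatible r
  have h8 := List.prefix_or_prefix_of_prefix h5 h6
  cases b
  · exact h8.elim h7.1 h7.2
  · exact h8.elim h7.2 h7.1

end IsScheme

/-- The meet `τ` will be the splitting node; its maximality places it above any node below both
sequences. -/
theorem exists_common_prefix_of_incompatible {u v : List ℕ} (h : Incompatible u v) :
    ∃ τ m n, m < n ∧ (τ ++ [m] <+: u ∧ τ ++ [n] <+: v ∨ τ ++ [n] <+: u ∧ τ ++ [m] <+: v) ∧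
      ∀ ρ, ρ <+: u → ρ <+: v → ρ <+: τ := by
  induction u generalizing v with
  | nil => exact absurd List.nil_prefix h.1
  | cons a u ih =>
    cases v with
    | nil => exact absurd List.nil_prefix h.2
    | cons c v =>
      by_cases hac : a = c
      · subst hac
        have h' : Incompatible u v := by
          simpa [Incompatible, List.cons_prefix_cons] using h
        obtain ⟨τ, m, n, hmn, h1, h2⟩ := ih h'
        refine ⟨a :: τ, m, n, hmn, by simpa [List.cons_prefix_cons] using h1, ?_⟩
        intro ρ hu hv
        cases ρ with
        | nil => simp
        | cons d ρ =>
          simp only [List.cons_prefix_cons] at hu hv ⊢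
          exact ⟨hu.1, h2 ρ hu.2 hv.2⟩
      · have h2 : ∀ ρ, ρ <+: a :: u → ρ <+: c :: v → ρ <+: [] := by
          intro ρ hu hv
          cases ρ with
          | nil => simp
          | cons d ρ =>
            simp only [List.cons_prefix_cons] at hu hv
            exact absurd (hu.1.symm.trans hv.1) hac
        rcases lt_or_gt_of_ne hac with hlt | hlt
        · exact ⟨[], a, c, hlt, Or.inl (by simp [List.cons_prefix_cons]), h2⟩
        · exact ⟨[], c, a, hlt, Or.inr (by simp [List.cons_prefix_cons]), h2⟩

/-- The tree of a scheme of increasing sequences is a Sacks tree. -/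
theorem IsScheme.mem_sacksTrees {g : List Bool → List ℕ} (hg : IsScheme g)
    (hinc : ∀ s, (g s).Pairwise (· < ·)) : schemeTree g ∈ sacksTrees := by
  refine ⟨prefixes_mem_tree g, ⟨g [], [], List.prefix_refl _⟩, ?_, ?_⟩
  · rintro σ ⟨s, hs⟩
    exact (hinc s).sublist hs.sublist
  · rintro σ ⟨s, hs⟩
    obtain ⟨τ, m, n, hmn, h1, h2⟩ := exists_common_prefix_of_incompatible (hg.incompatible s)
    refine ⟨τ, h2 σ (hs.trans (hg.prefix_cons _ _)) (hs.trans (hg.prefix_cons _ _)), ?_, m, n,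
      hmn, ?_⟩
    · rcases h1 with h1 | h1 <;>
        exact ⟨_, (List.prefix_append τ _).trans h1.1⟩
    · rcases h1 with h1 | h1
      · exact ⟨⟨_, h1.1⟩, ⟨_, h1.2⟩⟩
      · exact ⟨⟨_, h1.2⟩, ⟨_, h1.1⟩⟩

/-- A tree in which every node has two extensions related by `R` contains a scheme whose successors
are related by `R`. -/
theorem exists_scheme {T : Set (List ℕ)} (hT : T.Nonempty) {R : List ℕ → List ℕ → Prop}
    (hR : ∀ u v, R u v → Incompatible u v)
    (h : ∀ σ ∈ T, ∃ u ∈ T, ∃ v ∈ T, σ <+: u ∧ σ <+: v ∧ R u v) :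
    ∃ g, IsScheme g ∧ (∀ s, g s ∈ T) ∧ ∀ s, R (g (false :: s)) (g (true :: s)) := by
  obtain ⟨σ₀, h₀⟩ := hT
  choose! U hU V hV hσU hσV hUV using h
  let g : List Bool → List ℕ := fun s => s.rec σ₀ fun b _ ih => if b then V ih else U ih
  have hgT : ∀ s, g s ∈ T := by
    intro s
    induction s with
    | nil => exact h₀
    | cons b s ih =>
      cases b
      · exact hU _ ih
      · exact hV _ ih
  have hgR : ∀ s, R (g (false :: s)) (g (true :: s)) := fun s => hUV _ (hgT s)
  refine ⟨g, ⟨?_, fun s => hR _ _ (hgR s)⟩, hgT, hgR⟩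
  intro b s
  cases b
  · exact hσU _ (hgT s)
  · exact hσV _ (hgT s)

theorem schemeTree_subset {T : Set (List ℕ)} (hT : T ∈ Descriptive.tree ℕ)
    {g : List Bool → List ℕ} (hg : ∀ s, g s ∈ T) : schemeTree g ⊆ T := by
  rintro σ ⟨s, hs⟩
  exact mem_of_prefix hT hs (hg s)

/-! ### Disjoint Sacks subtrees -/

/-- Insert the digits of `z` between those of `s`. -/
def interleave (z : ℕ → Bool) : List Bool → List Bool
  | [] => []
  | b :: s => b :: z s.length :: interleave z s

theorem length_interleave (z : ℕ → Bool) (s : List Bool) :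
    (interleave z s).length = 2 * s.length := by
  induction s with
  | nil => rfl
  | cons b s ih => simp [interleave, ih]; ring

theorem IsScheme.interleave {g : List Bool → List ℕ} (hg : IsScheme g) (z : ℕ → Bool) :
    IsScheme fun s => g (interleave z s) where
  prefix_cons _ _ := (hg.prefix_cons _ _).trans (hg.prefix_cons _ _)
  incompatible _ := hg.incompatible _

/-- A Sacks tree contains continuum many Sacks trees with pairwise disjoint bodies. -/
theorem exists_disjoint_sacks_subtrees {T : Set (List ℕ)} (hT : T ∈ sacksTrees) :
    ∃ S : (ℕ → Bool) → Set (List ℕ), (∀ z, S z ∈ sacksTrees ∧ S z ⊆ T) ∧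
      ∀ z w x, x ∈ body (S z) → x ∈ body (S w) → z = w := by
  obtain ⟨htree, hne, hinc, hsplit⟩ := hT
  obtain ⟨g, hg, hgT, -⟩ := exists_scheme (R := Incompatible) hne (fun _ _ h => h) (by
    intro σ hσ
    obtain ⟨τ, hτ, -, m, n, hmn, hm, hn⟩ := hsplit σ hσ
    refine ⟨_, hm, _, hn, hτ.trans (List.prefix_append _ _), hτ.trans (List.prefix_append _ _), ?_⟩
    constructor <;> intro h <;> have := h.eq_of_length (by simp) <;> simp at this <;> omega)
  refine ⟨fun z => schemeTree fun s => g (interleave z s), fun z =>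
    ⟨(hg.interleave z).mem_sacksTrees fun s => hinc _ (hgT _),
      schemeTree_subset htree fun s => hgT _⟩, ?_⟩
  intro z w x hz hw
  funext n
  -- An index of length `n + 1` is the shortest whose interleaving records the digit `z n`.
  obtain ⟨s, hs, hxs⟩ := (hg.interleave z).exists_prefix_of_mem_body hz (n + 1)
  obtain ⟨t, ht, hxt⟩ := (hg.interleave w).exists_prefix_of_mem_body hw (n + 1)
  have h := hg.eq_of_init (by rw [length_interleave, length_interleave, hs, ht]) hxs hxt
  cases s with
  | nil => simp at hs
  | cons b s =>
    cases t with
    | nil => simp at ht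
    | cons c t =>
      simp only [Paradise.interleave, List.cons.injEq] at h
      simp only [List.length_cons, Nat.add_right_cancel_iff] at hs ht
      rw [hs, ht] at h
      exact h.2.1

/-! ### Homogeneous sets -/

/-- Comparability of the ranges under inclusion. -/
def Comparable (x y : IncReal) : Prop :=
  x.toSet ⊆ y.toSet ∨ y.toSet ⊆ x.toSet

/-- Sets of pairwise comparable or of pairwise incomparable reals. -/
def Homogeneous (K : Set IncReal) : Prop :=
  (∀ x ∈ K, ∀ y ∈ K, Comparable x y) ∨ ∀ x ∈ K, ∀ y ∈ K, x ≠ y → ¬ Comparable x y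

/-- Finite sequences witnessing that extensions of `u` are not included in extensions of `v`. -/
def Excludes (u v : List ℕ) : Prop :=
  ∃ k ∈ u, k ∉ v ∧ ∃ m ∈ v, k < m

theorem Excludes.not_prefix {u v : List ℕ} (h : Excludes u v) : ¬ u <+: v := by
  obtain ⟨k, hu, hv, -⟩ := h
  exact fun hp => hv (hp.subset hu)

theorem Excludes.not_subset {x y : IncReal} {m n : ℕ} (h : Excludes (x.init m) (y.init n)) :
    ¬ x.toSet ⊆ y.toSet := by
  obtain ⟨k, hu, hv, l, hl, hkl⟩ := h
  intro hsub
  obtain ⟨j, rfl⟩ := hsub (IncReal.mem_toSet_of_mem_init hu)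
  simp only [IncReal.init, List.mem_map, List.mem_range] at hl hv
  obtain ⟨i, hi, rfl⟩ := hl
  -- Since `y` is increasing and has already passed `k`, a value `k` would have to occur earlier in
  -- the segment.
  exact hv ⟨j, (y.2.lt_iff_lt.1 hkl).trans hi, rfl⟩

theorem exists_excludes {x y : IncReal} (h : ¬ x.toSet ⊆ y.toSet) :
    ∃ N, ∀ n ≥ N, Excludes (x.init n) (y.init n) := by
  obtain ⟨k, hx, hy⟩ := Set.not_subset.1 h
  -- From length `k + 2` on, the segment of `y` contains `y (k + 1)`, which exceeds `k`.
  refine ⟨k + 2, fun n hn => ⟨k, IncReal.mem_init hx (by omega),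
    fun h => hy (IncReal.mem_toSet_of_mem_init h), y.1 (k + 1), ?_, ?_⟩⟩
  · simp only [IncReal.init, List.mem_map, List.mem_range]
    exact ⟨k + 1, by omega, rfl⟩
  · have := y.2.le_apply (x := k + 1)
    omega

theorem sacks_restrict {T : Set (List ℕ)} (hT : T ∈ sacksTrees) {σ : List ℕ} (hσ : σ ∈ T) :
    {τ | τ ∈ T ∧ (τ <+: σ ∨ σ <+: τ)} ∈ sacksTrees := by
  obtain ⟨htree, hne, hinc, hsplit⟩ := hT
  have hext : ∀ ρ ∈ T, σ <+: ρ → ∃ τ, ρ <+: τ ∧ IsSplit {τ | τ ∈ T ∧ (τ <+: σ ∨ σ <+: τ)} τ := by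
    intro ρ hρ hσρ
    obtain ⟨τ, hτ, hτT, m, n, hmn, hm, hn⟩ := hsplit ρ hρ
    exact ⟨τ, hτ, ⟨hτT, Or.inr (hσρ.trans hτ)⟩, m, n, hmn,
      ⟨hm, Or.inr ((hσρ.trans hτ).trans (List.prefix_append _ _))⟩,
      ⟨hn, Or.inr ((hσρ.trans hτ).trans (List.prefix_append _ _))⟩⟩
  refine ⟨?_, ⟨σ, hσ, Or.inl (List.prefix_refl _)⟩, fun τ hτ => hinc τ hτ.1, ?_⟩
  · rintro τ a ⟨hτ, h⟩
    refine ⟨mem_of_prefix htree (List.prefix_append _ _) hτ, ?_⟩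
    rcases h with h | h
    · exact Or.inl ((List.prefix_append _ _).trans h)
    · exact List.prefix_or_prefix_of_prefix (List.prefix_append _ _) h
  · rintro ρ ⟨hρ, h | h⟩
    · obtain ⟨τ, hτ, hs⟩ := hext σ hσ (List.prefix_refl _)
      exact ⟨τ, h.trans hτ, hs⟩
    · exact hext ρ hρ h

/-- Every Sacks tree has a Sacks subtree whose body is a chain or an antichain under inclusion. -/
theorem exists_homogeneous_subtree {T : Set (List ℕ)} (hT : T ∈ sacksTrees) :
    ∃ S ∈ sacksTrees, S ⊆ T ∧ Homogeneous (body S) := by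
  by_cases hc : ∃ σ ∈ T, ∀ x ∈ body T, ∀ y ∈ body T, x.init σ.length = σ → y.init σ.length = σ →
      Comparable x y
  · obtain ⟨σ, hσ, hc⟩ := hc
    have hthrough : ∀ x ∈ body {τ | τ ∈ T ∧ (τ <+: σ ∨ σ <+: τ)}, x.init σ.length = σ := by
      intro x hx
      rcases (hx σ.length).2 with h | h
      · exact h.eq_of_length (by simp)
      · exact (h.eq_of_length (by simp)).symm
    exact ⟨_, sacks_restrict hT hσ, fun τ hτ => hτ.1, Or.inl fun x hx y hy =>
      hc x (fun n => (hx n).1) y (fun n => (hy n).1) (hthrough x hx) (hthrough y hy)⟩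
  -- Now every node has two incomparable branches through it. Finite segments witness this, so a
  -- scheme can make all siblings exclude each other.
  · push Not at hc
    obtain ⟨htree, hne, hinc, -⟩ := hT
    obtain ⟨g, hg, hgT, hgR⟩ := exists_scheme (R := fun u v => Excludes u v ∧ Excludes v u) hne
      (fun u v h => ⟨h.1.not_prefix, h.2.not_prefix⟩) (by
        intro σ hσ
        obtain ⟨x, hx, y, hy, hxσ, hyσ, hxy⟩ := hc σ hσ
        simp only [Comparable, not_or] at hxy
        obtain ⟨N, hN⟩ := exists_excludes hxy.1
        obtain ⟨M, hM⟩ := exists_excludes hxy.2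
        exact ⟨x.init (N + M + σ.length), hx _, y.init (N + M + σ.length), hy _,
          IncReal.prefix_init hxσ (by omega), IncReal.prefix_init hyσ (by omega),
          hN _ (by omega), hM _ (by omega)⟩)
    refine ⟨schemeTree g, hg.mem_sacksTrees fun s => hinc _ (hgT s), schemeTree_subset htree hgT,
      Or.inr fun x hx y hy hxy => ?_⟩
    obtain ⟨r, b, h1, h2⟩ := hg.exists_separation hx hy hxy
    have h3 : Excludes (g (b :: r)) (g ((!b) :: r)) ∧ Excludes (g ((!b) :: r)) (g (b :: r)) := by
      cases b
      · exact hgR r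
      · exact (hgR r).symm
    rw [← h1, ← h2] at h3
    exact not_or.2 ⟨h3.1.not_subset, h3.2.not_subset⟩

/-! ### Covering the body of a willow tree -/

/-- Fewer than `#α` subsets of `α` with at most one element each do not cover `α`. -/
theorem exists_forall_not_mem_of_mk_lt {ι α : Type} {A : Set ι} (hA : #A < #α)
    (F : ι → Set α) (hF : ∀ i ∈ A, (F i).Subsingleton) : ∃ z, ∀ i ∈ A, z ∉ F i := by
  by_contra! h
  choose i hi hz using h
  refine hA.not_ge (mk_le_of_injective (f := fun z => (⟨i z, hi z⟩ : A)) ?_)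
  intro z w hzw
  have : i z = i w := congrArg Subtype.val hzw
  exact hF (i z) (hi z) (hz z) (this ▸ hz w)

theorem body_tree_of_mem_reals {c : WillowCondition} {x : IncReal} (hx : x ∈ c.reals) :
    x ∈ body c.tree :=
  fun n => ⟨x, hx, n, rfl⟩

/-- An injective sequence of blocks embeds the infinite subsets of the index set into the
reals of a willow condition, preserving and reflecting inclusion. -/
theorem WillowCondition.exists_real (c : WillowCondition) {ι : Type*} {a : ι → Finset ℕ}
    (ha : Function.Injective a) (hac : ∀ i, a i ∈ c.blocks) :
    ∃ p : {B : Set ι // B.Infinite} → IncReal, (∀ B, p B ∈ c.reals) ∧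
      ∀ B C, (p B).toSet ⊆ (p C).toSet ↔ B.1 ⊆ C.1 := by
  have huniq : ∀ b ∈ c.blocks, ∀ b' ∈ c.blocks, ∀ k, k ∈ b → k ∈ b' → b = b' := by
    intro b hb b' hb' k hk hk'
    by_contra hne
    exact Finset.disjoint_left.1 (c.pairwiseDisjoint b hb b' hb' hne) hk hk'
  -- Blocks indexed by `B` are put in; all other blocks, including those not of the form `a i`, are
  -- left out.
  let D : Set ι → Set ℕ := fun B =>
    {k | (∃ h : ∀ b ∈ c.blocks, k ∉ b, c.f ⟨k, h⟩ = true) ∨ ∃ i ∈ B, k ∈ a i}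
  have hmem : ∀ B i k, k ∈ a i → (k ∈ D B ↔ i ∈ B) := by
    intro B i k hk
    constructor
    · rintro (⟨h, -⟩ | ⟨j, hj, hkj⟩)
      · exact absurd hk (h _ (hac i))
      · rwa [ha (huniq _ (hac i) _ (hac j) k hk hkj)]
    · exact fun hi => Or.inr ⟨i, hi, hk⟩
  have hinf : ∀ B : Set ι, B.Infinite → (D B).Infinite := by
    intro B hB
    choose e he using fun i => c.nonempty_of_mem (a i) (hac i)
    have hinj : Function.Injective e := fun i j hij =>
      ha (huniq _ (hac i) _ (hac j) (e i) (he i) (hij ▸ he j))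
    refine (hB.image hinj.injOn).mono ?_
    rintro _ ⟨i, hi, rfl⟩
    exact (hmem B i _ (he i)).2 hi
  choose p hp using fun B : {B : Set ι // B.Infinite} => exists_toSet_eq (hinf B.1 B.2)
  refine ⟨p, fun B => ⟨?_, ?_⟩, fun B C => ?_⟩
  · rintro ⟨k, hk⟩
    rw [hp]
    constructor
    · rintro (⟨h, hf⟩ | ⟨i, -, hi⟩)
      · exact hf
      · exact absurd hi (hk _ (hac i))
    · exact fun hf => Or.inl ⟨hk, hf⟩
  · intro b hb
    rw [hp]
    by_cases h : ∃ i ∈ B.1, a i = b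
    · obtain ⟨i, hi, rfl⟩ := h
      exact Or.inl fun k hk => (hmem _ i k hk).2 hi
    · refine Or.inr fun k hk => ?_
      rintro (⟨h', -⟩ | ⟨i, hi, hki⟩)
      · exact h' b hb hk
      · exact h ⟨i, hi, huniq _ (hac i) _ hb k hki hk⟩
  · rw [hp, hp]
    constructor
    · intro h i hi
      obtain ⟨k, hk⟩ := c.nonempty_of_mem _ (hac i)
      exact (hmem _ i k hk).1 (h ((hmem _ i k hk).2 hi))
    · rintro h k (hk | ⟨i, hi, hk⟩)
      · exact Or.inl hk
      · exact Or.inr ⟨i, h hi, hk⟩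

/-- A willow tree has branches indexed by `ℝ × 2^ω` of which two are comparable precisely when
their second coordinates agree. -/
theorem WillowCondition.exists_grid (c : WillowCondition) :
    ∃ p : ℝ → (ℕ → Bool) → IncReal, (∀ r d, p r d ∈ c.reals) ∧
      (∀ r r' d, p r d = p r' d → r = r') ∧
      ∀ r d r' d', Comparable (p r d) (p r' d') ↔ d = d' := by
  let e := c.infinite_blocks.natEmbedding
  let a : ℚ ⊕ (ℕ × Bool) → Finset ℕ := fun i => (e (Encodable.encode i)).1
  have ha : Function.Injective a := fun i j hij =>
    Encodable.encode_injective (e.injective (Subtype.ext hij))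
  obtain ⟨p, hp, hsub⟩ := c.exists_real ha fun i => (e (Encodable.encode i)).2
  -- The Dedekind cut of `r` together with the graph of `d`: cuts are nested, while no graph of a
  -- function is included in another. The graph also makes the set infinite.
  let q : ℝ → (ℕ → Bool) → Set (ℚ ⊕ (ℕ × Bool)) := fun r d =>
    {i | (∃ t : ℚ, (t : ℝ) < r ∧ i = Sum.inl t) ∨ ∃ n, i = Sum.inr (n, d n)}
  have hq : ∀ r d, (q r d).Infinite := by
    intro r d
    refine (Set.infinite_range_of_injective (f := fun n => (Sum.inr (n, d n) : ℚ ⊕ (ℕ × Bool))) ?_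
      ).mono ?_
    · intro m n h
      simpa using congrArg (Sum.elim (fun _ => 0) Prod.fst) h
    · rintro _ ⟨n, rfl⟩
      exact Or.inr ⟨n, rfl⟩
  have hle : ∀ r d r' d', q r d ⊆ q r' d' ↔ r ≤ r' ∧ d = d' := by
    intro r d r' d'
    constructor
    · intro h
      constructor
      · by_contra! hlt
        obtain ⟨t, h1, h2⟩ := exists_rat_btwn hlt
        have := h (show Sum.inl t ∈ q r d from Or.inl ⟨t, h2, rfl⟩)
        rcases this with ⟨t', ht', heq⟩ | ⟨n, heq⟩
        · cases heq
          exact lt_asymm h1 ht'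
        · cases heq
      · funext n
        have := h (show Sum.inr (n, d n) ∈ q r d from Or.inr ⟨n, rfl⟩)
        rcases this with ⟨t', -, heq⟩ | ⟨m, heq⟩
        · cases heq
        · simp only [Sum.inr.injEq, Prod.mk.injEq] at heq
          rw [heq.2, heq.1]
    · rintro ⟨hr, rfl⟩ i (⟨t, ht, rfl⟩ | ⟨n, rfl⟩)
      · exact Or.inl ⟨t, ht.trans_le hr, rfl⟩
      · exact Or.inr ⟨n, rfl⟩
  have hsub' : ∀ r d r' d', (p ⟨q r d, hq r d⟩).toSet ⊆ (p ⟨q r' d', hq r' d'⟩).toSet ↔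
      r ≤ r' ∧ d = d' := fun r d r' d' => (hsub _ _).trans (hle r d r' d')
  refine ⟨fun r d => p ⟨q r d, hq r d⟩, fun r d => hp _, ?_, ?_⟩
  · intro r r' d h
    exact le_antisymm ((hsub' r d r' d).1 (by simp only [h]; exact subset_rfl)).1
      ((hsub' r' d r d).1 (by simp only [h]; exact subset_rfl)).1
  · intro r d r' d'
    simp only [Comparable, hsub']
    constructor
    · rintro (h | h)
      · exact h.2
      · exact h.2.symm
    · rintro rfl
      exact (le_total r r').imp (fun h => ⟨h, rfl⟩) (fun h => ⟨h, rfl⟩)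

/-- The reals of a willow condition are not covered by fewer than continuum many homogeneous
sets. -/
theorem WillowCondition.exists_mem_reals_not_mem (c : WillowCondition) {ι : Type} {A : Set ι}
    (hA : #A < 𝔠) (K : ι → Set IncReal) (hK : ∀ i ∈ A, Homogeneous (K i)) :
    ∃ x ∈ c.reals, ∀ i ∈ A, x ∉ K i := by
  obtain ⟨p, hp, hinj, hcomp⟩ := c.exists_grid
  obtain ⟨d, hd⟩ := exists_forall_not_mem_of_mk_lt (α := ℕ → Bool) (A := A) (by simpa using hA)
    (fun i => {d | (∀ x ∈ K i, ∀ y ∈ K i, Comparable x y) ∧ ∃ r, p r d ∈ K i}) (by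
      rintro i - d ⟨hc, r, hr⟩ d' ⟨-, r', hr'⟩
      exact (hcomp r d r' d').1 (hc _ hr _ hr'))
  obtain ⟨r, hr⟩ := exists_forall_not_mem_of_mk_lt (α := ℝ) (A := A) (by rwa [mk_real])
    (fun i => {r | (∀ x ∈ K i, ∀ y ∈ K i, x ≠ y → ¬ Comparable x y) ∧ p r d ∈ K i}) (by
      rintro i - r ⟨hc, hr⟩ r' ⟨-, hr'⟩
      by_contra hne
      exact hc _ hr _ hr' (fun h => hne (hinj _ _ _ h)) ((hcomp _ _ _ _).2 rfl))
  refine ⟨p r d, hp r d, fun i hi hmem => ?_⟩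
  rcases hK i hi with h | h
  · exact hd i hi ⟨h, r, hmem⟩
  · exact hr i hi ⟨h, hmem⟩

/-! ### The diagonalization -/

/-- A type of cardinality at most the continuum carries a trichotomous relation with small initial
segments. -/
theorem exists_trichotomous_small_initial_segments (α : Type) (hα : #α ≤ 𝔠) :
    ∃ r : α → α → Prop, (∀ a b, r a b ∨ a = b ∨ r b a) ∧ ∀ b, #{a | r a b} < 𝔠 := by
  -- The order type is an initial ordinal, so proper initial segments have fewer than `#α` elements.
  obtain ⟨r, wo, hr⟩ := exists_ord_eq α
  exact ⟨r, fun a b => trichotomous_of r a b, fun b => (card_typein_lt b hr).trans_le hα⟩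

/-- Without a willow tree every set would be willow-null vacuously. Taking all singletons as blocks
leaves `f` with empty domain. -/
theorem willowTrees_nonempty : willowTrees.Nonempty := by
  refine ⟨_, ⟨Set.range fun n => {n}, Set.infinite_range_of_injective Finset.singleton_injective,
    ?_, ?_, fun _ => false⟩, rfl⟩
  · rintro _ ⟨n, rfl⟩
    exact Finset.singleton_nonempty n
  · rintro _ ⟨m, rfl⟩ _ ⟨n, rfl⟩ h
    exact Finset.disjoint_singleton.2 fun hmn => h (hmn ▸ rfl)

theorem exists_sacks_null_not_willow_null : ∃ X, X ∈ sacksIdeal ∧ X ∉ willowIdeal := by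
  obtain ⟨r, htri, hsmall⟩ := exists_trichotomous_small_initial_segments (Set (List ℕ))
    (by rw [mk_set, mk_eq_aleph0, two_power_aleph0])
  have hx : ∀ W, ∃ x : IncReal, W ∈ willowTrees →
      x ∈ body W ∧ ∀ S, r S W → Homogeneous (body S) → x ∉ body S := by
    intro W
    by_cases hW : W ∈ willowTrees
    · obtain ⟨c, rfl⟩ := hW
      obtain ⟨x, hx, hxS⟩ := c.exists_mem_reals_not_mem
        (A := {S | r S c.tree ∧ Homogeneous (body S)})
        ((mk_le_mk_of_subset fun S hS => hS.1).trans_lt (hsmall c.tree)) body fun S hS => hS.2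
      exact ⟨x, fun _ => ⟨body_tree_of_mem_reals hx, fun S h1 h2 => hxS S ⟨h1, h2⟩⟩⟩
    · exact ⟨⟨id, strictMono_id⟩, fun h => absurd h hW⟩
  choose x hx using hx
  refine ⟨x '' willowTrees, ?_, ?_⟩
  · intro T hT
    obtain ⟨S, hS, hST, hhom⟩ := exists_homogeneous_subtree hT
    obtain ⟨Z, hZ, hdisj⟩ := exists_disjoint_sacks_subtrees hS
    -- `S` itself is inserted because it may also be a willow tree, and `x S` was only made to avoid
    -- strictly earlier bodies.
    have hcard : #(insert S {W | r W S} : Set (Set (List ℕ))) < 𝔠 :=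
      mk_insert_le.trans_lt (add_lt_of_lt aleph0_le_continuum (hsmall S)
        (nat_lt_continuum 1 |>.trans_eq' (by simp)))
    obtain ⟨z, hz⟩ := exists_forall_not_mem_of_mk_lt (α := ℕ → Bool) (by simpa using hcard)
      (fun W => {z | x W ∈ body (Z z)}) (fun W _ z hz w hw => hdisj z w _ hz hw)
    refine ⟨Z z, (hZ z).1, (hZ z).2.trans hST, ?_⟩
    rw [Set.eq_empty_iff_forall_notMem]
    rintro _ ⟨⟨W, hW, rfl⟩, hWz⟩
    rcases htri W S with h | h | h
    · exact hz W (Or.inr h) hWz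
    · exact hz W (Or.inl h) hWz
    · exact (hx W hW).2 S h hhom fun n => (hZ z).2 (hWz n)
  · intro hX
    obtain ⟨W, hW⟩ := willowTrees_nonempty
    obtain ⟨S, hS, -, hempty⟩ := hX W hW
    exact Set.eq_empty_iff_forall_notMem.1 hempty (x S) ⟨⟨S, hS, rfl⟩, (hx S hS).1⟩

end Paradise

theorem theorem2p8 : (Paradise.sacksIdeal \ Paradise.willowIdeal).Nonempty := by
  obtain ⟨X, hs, hw⟩ := Paradise.exists_sacks_null_not_willow_null
  exact ⟨X, hs, hw⟩
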